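/- Let $J$ (source nodes) and $Q$ (target nodes) be finite sets and let $\mathcal{E}\subseteq J\times Q$ be a set of links. Let the following be given: capacities $c_j>0$ ($j\in J$); perception coefficients $m_{jq}\in\mathbb{R}$; punishment coefficients $c_{jq}\ge 0$; a weight $\lambda\ge 0$; exponents $\beta_1,\beta_2\in[0,1]$; bounds $n_q(1)=\underline{n}_q\ge 0$ and $n_q(2)=\bar{n}_q\ge 0$ ($q\in Q$); and, for every $q\in Q$, a probability distribution $\mu_q$ on $\{1,2\}$. The Bayesian game $\mathcal{G}$ of adversarial regularized optimal transport between a dispatcher and an adversary is defined as follows. - The adversary's type $\theta=(\theta_q)_{q\in Q}$ lies in $\Theta=\{1,2\}^{Q}$ and is private; the common belief on $\Theta$ is $\mu(\theta)=\prod_{q\in Q}\mu_q(\theta_q)$. - The dispatcher chooses a transport plan in $$X=\Big\{x\in\mathbb{R}^{J\times Q} : x\ge 0,\ x_{jq}=0 \text{ for } (j,q)\notin\mathcal{E},\ \sum_{q\in Q}x_{jq}\le c_j \text{ for all } j\in J\Big\}.$$ - The adversary of type $\theta$ chooses an action in $\Xi(\theta)=\prod_{q\in Q}[0,n_q(\theta_q)]$.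 A strategy of the adversary is a family $\xi=(\xi_q(t))_{q\in Q,\,t\in\{1,2\}}$ with $0\le\xi_q(t)\le n_q(t)$; at the type $\theta$ it prescribes the action $\xi(\theta)=(\xi_q(\theta_q))_{q\in Q}\in\Xi(\theta)$. - The dispatcher maximizes the expected regularized utility (with $0\log 0=0$) $$U^{(p)}(x,\xi)=\sum_{(j,q)\in\mathcal{E}}\Big[\sum_{t\in\{1,2\}}\big(m_{jq}+t\,\xi_q(t)\big)\mu_q(t)\,x_{jq}-\lambda\,x_{jq}\log x_{jq}\Big].$$ - The adversary of type $\theta$ minimizes over $\eta\in\Xi(\theta)$ the cost $$U^{(a)}(x,\eta;\theta)=\sum_{(j,q)\in\mathcal{E}}\Big[c_{jq}\,\eta_q^{-\beta_2}\,x_{jq}^{\beta_1}+\big(m_{jq}+\theta_q\,\eta_q\big)x_{jq}\Big]\in(-\infty,+\infty],$$ with the conventions $0^{-\beta_2}=+\infty$ if $\beta_2>0$, $0^0=1$ and $0\cdot(+\infty)=0$. Then $\mathcal{G}$ has a Bayesian equilibrium: there are a plan $x^*\in X$ and a strategy $\xi^*$ of the adversary such that $$U^{(p)}(x^*,\xi^*)\ge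 U^{(p)}(x,\xi^*)\quad\text{for all } x\in X,$$ $$U^{(a)}(x^*,\xi^*(\theta);\theta)\le U^{(a)}(x^*,\eta;\theta)\quad\text{for all } \theta\in\Theta \text{ and all } \eta\in\Xi(\theta).$$ -/

import Mathlib

open scoped ENNReal

namespace AdversarialOT

/-- The two possible sub-types of the adversary at a target node: minor crimes (`θ_q = 1`)
or major crimes (`θ_q = 2`). -/
inductive Offense where
  | minor
  | major
  deriving DecidableEq

instance : Fintype Offense where
  elems := {Offense.minor, Offense.major}
  complete := fun t => by cases t <;> decide

/-- The numerical value `1` or `2` of a sub-type. -/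
def Offense.level : Offense → ℝ
  | .minor => 1
  | .major => 2

/-- The data of the Bayesian game of adversarial regularized optimal transport on a bipartite
network with source nodes `J` and target nodes `Q`. -/
structure Game (J Q : Type*) where
  /-- the set of links -/
  links : Finset (J × Q)
  /-- the capacity `c_j` of each source node -/
  capacity : J → ℝ
  capacity_pos : ∀ j, 0 < capacity j
  /-- the perception coefficients `m_{jq}` -/
  perception : J → Q → ℝ
  /-- the punishment coefficients `c_{jq}` -/
  punishment : J → Q → ℝ
  punishment_nonneg : ∀ j q, 0 ≤ punishment j q
  /-- the weight `λ` of the entropic regularizer -/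
  regWeight : ℝ
  regWeight_nonneg : 0 ≤ regWeight
  /-- the exponent `β₁` -/
  beta₁ : ℝ
  beta₁_mem : beta₁ ∈ Set.Icc (0 : ℝ) 1
  /-- the exponent `β₂` -/
  beta₂ : ℝ
  beta₂_mem : beta₂ ∈ Set.Icc (0 : ℝ) 1
  /-- the upper bound on the adversary's action at each target node, for each sub-type -/
  bound : Q → Offense → ℝ
  bound_nonneg : ∀ q t, 0 ≤ bound q t
  /-- the dispatcher's belief on the sub-type at each target node -/
  belief : Q → Offense → ℝ
  belief_nonneg : ∀ q t, 0 ≤ belief q t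
  belief_sum : ∀ q, ∑ t, belief q t = 1

namespace Game

variable {J Q : Type*}

/-- The dispatcher's strategy space `X`: nonnegative transport plans, carried by the links of the
network, that respect the capacity of every source node. -/
def plans [Fintype Q] (G : Game J Q) : Set (J → Q → ℝ) :=
  {x | (∀ j q, 0 ≤ x j q) ∧ (∀ j q, (j, q) ∉ G.links → x j q = 0) ∧
    ∀ j, ∑ q, x j q ≤ G.capacity j}

/-- The adversary's action space `Ξ(θ)` when his type is `θ ∈ Θ = ∏_q {1, 2}`. -/
def actions (G : Game J Q) (θ : Q → Offense) : Set (Q → ℝ) :=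
  {η | ∀ q, 0 ≤ η q ∧ η q ≤ G.bound q (θ q)}

/-- The action `ξ(θ) = (ξ_q(θ_q))_q` that a behavioral strategy prescribes at the type `θ`. -/
def play (ξ : Q → Offense → ℝ) (θ : Q → Offense) : Q → ℝ := fun q => ξ q (θ q)

/-- The dispatcher's expected utility
`U^{(p)}(x, ξ) = ∑_{(j,q)} [∑_{t ∈ {1,2}} (m_{jq} + t ξ_q(t)) μ_q(t) x_{jq} - λ x_{jq} log x_{jq}]`.
Here `0 log 0 = 0`. -/
noncomputable def dispatcherUtility (G : Game J Q) (x : J → Q → ℝ) (ξ : Q → Offense → ℝ) : ℝ :=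
  ∑ e ∈ G.links,
    ((∑ t : Offense,
        (G.perception e.1 e.2 + t.level * ξ e.2 t) * G.belief e.2 t * x e.1 e.2)
      - G.regWeight * (x e.1 e.2 * Real.log (x e.1 e.2)))

/-- The adversary's cost of the action `η` at the type `θ`,
`U^{(a)}(x, η) = ∑_{(j,q)} [c_{jq} η_q^{-β₂} x_{jq}^{β₁} + (m_{jq} + θ_q η_q) x_{jq}]`.
The penalty is computed in `[0, ∞]`: for `β₂ > 0` one has `0 ^ (-β₂) = ∞`, so that the action
`η_q = 0` has an infinite cost as soon as some `c_{jq} x_{jq}^{β₁}` is positive;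
moreover `0 * ∞ = 0` and `0 ^ 0 = 1`. -/
noncomputable def adversaryCost (G : Game J Q) (x : J → Q → ℝ) (η : Q → ℝ) (θ : Q → Offense) :
    EReal :=
  ∑ e ∈ G.links,
    (((ENNReal.ofReal (G.punishment e.1 e.2) * ENNReal.ofReal (η e.2) ^ (-G.beta₂)
        * ENNReal.ofReal (x e.1 e.2) ^ G.beta₁ : ℝ≥0∞) : EReal)
      + (((G.perception e.1 e.2 + (θ e.2).level * η e.2) * x e.1 e.2 : ℝ) : EReal))

/-- A Bayesian equilibrium: an admissible strategy profile in which the transport plan `x`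
maximizes the dispatcher's expected utility, and at every type `θ` the action `ξ(θ)` minimizes
the adversary's cost over `Ξ(θ)`. -/
structure IsBayesianEquilibrium [Fintype Q] (G : Game J Q)
    (x : J → Q → ℝ) (ξ : Q → Offense → ℝ) : Prop where
  plan_mem : x ∈ G.plans
  play_mem : ∀ θ, play ξ θ ∈ G.actions θ
  dispatcher_best : ∀ y ∈ G.plans, G.dispatcherUtility y ξ ≤ G.dispatcherUtility x ξ
  adversary_best : ∀ θ, ∀ η ∈ G.actions θ,
    G.adversaryCost x (play ξ θ) θ ≤ G.adversaryCost x η θ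

/-- The common belief `μ(θ) = ∏_q μ_q(θ_q)` on the type space. -/
noncomputable def prior [Fintype Q] (G : Game J Q) (θ : Q → Offense) : ℝ :=
  ∏ q, G.belief q (θ q)

theorem sum_prior_mul [Fintype Q] [DecidableEq Q] (G : Game J Q) (q₀ : Q) (g : Offense → ℝ) :
    ∑ θ : Q → Offense, G.prior θ * g (θ q₀) = ∑ t, G.belief q₀ t * g t := by
  have h := Finset.prod_univ_sum (fun _ : Q => (Finset.univ : Finset Offense))
    (fun q t => G.belief q t * (if q = q₀ then g t else 1))
  rw [Fintype.piFinset_univ] at h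
  have h1 : ∀ θ : Q → Offense, G.prior θ * g (θ q₀)
      = ∏ q, G.belief q (θ q) * (if q = q₀ then g (θ q) else 1) := by
    intro θ
    rw [Finset.prod_mul_distrib, Finset.prod_ite_eq' Finset.univ q₀ (fun q => g (θ q))]
    simp [prior]
  rw [Finset.sum_congr rfl (fun θ _ => h1 θ), ← h,
    Finset.prod_eq_single q₀]
  · simp
  · intro q _ hq
    simp [hq, G.belief_sum q]
  · simp

/-- The dispatcher's utility is the expectation, over the common belief on the type space, of
the regularized linear utility at each type. -/
theorem dispatcherUtility_eq_expectation [Fintype Q] [DecidableEq Q] (G : Game J Q)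
    (x : J → Q → ℝ) (ξ : Q → Offense → ℝ) :
    G.dispatcherUtility x ξ = ∑ θ : Q → Offense, G.prior θ *
      ∑ e ∈ G.links, ((G.perception e.1 e.2 + (θ e.2).level * play ξ θ e.2) * x e.1 e.2
        - G.regWeight * (x e.1 e.2 * Real.log (x e.1 e.2))) := by
  simp_rw [Finset.mul_sum]
  rw [Finset.sum_comm]
  refine Finset.sum_congr rfl fun e _ => ?_
  rw [show (∑ θ : Q → Offense, G.prior θ *
      ((G.perception e.1 e.2 + (θ e.2).level * play ξ θ e.2) * x e.1 e.2
        - G.regWeight * (x e.1 e.2 * Real.log (x e.1 e.2)))) = _ from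
    G.sum_prior_mul e.2 (fun t => (G.perception e.1 e.2 + t.level * ξ e.2 t) * x e.1 e.2
        - G.regWeight * (x e.1 e.2 * Real.log (x e.1 e.2)))]
  simp_rw [mul_sub]
  rw [Finset.sum_sub_distrib,
    ← Finset.sum_mul (f := fun t => G.belief e.2 t)
      (a := G.regWeight * (x e.1 e.2 * Real.log (x e.1 e.2))), G.belief_sum, one_mul]
  congr 1
  exact Finset.sum_congr rfl fun t _ => by ring

end Game

end AdversarialOT

/-!
An equilibrium is found as a solution `z` of `φ z w ≤ 0` for all `w`, where `φ` is the bifunction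
`AdversarialOT.Game.deviationGain` on the compact convex set of strategy profiles, and the solution
is provided by the inequality of Ky Fan (`IsCompact.exists_forall_le_zero`).

The adversary's cost splits into one cost `A η ^ (-β₂) + C η` for every target node and sub-type,
where `A` and `C` depend on the transport plan. Its set of minimizers jumps when the plan makes `A`
and `C` vanish, and its derivative `C - β₂ A η ^ (-β₂ - 1)` is singular at `η = 0`. Multiplied by
`η ^ (1 + β₂)`, however, the derivative becomes `C η ^ (1 + β₂) - β₂ A`
(`AdversarialOT.Game.scaledSlope`), which is jointly continuous in the plan and the action, and the
variational inequality for this function on `[0, n]` still forces `η` to be a minimizer, at the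
degenerate plans as well (`AdversarialOT.nodeCost_le_of_variationalInequality`). The bifunction `φ`
combines these variational inequalities, linear in the deviation, with the dispatcher's utility
gain, which is concave in the deviation. Hence `φ` is continuous in `z`, concave in `w` and zero on the
diagonal, as the inequality of Ky Fan requires.

That inequality is reduced by compactness to finitely many deviations, and then to the fixed point
theorem of Brouwer on a simplex, through a map of the kind used by Nash. Brouwer's theorem follows
from the absence of a `C¹` retraction `r` of a ball onto its sphere
(`not_exists_contDiff_retraction_sphere`), proved after Milnor and Rogers: the integral over the
ball of the Jacobian of `x + t (r x - x)` is a polynomial in `t`, equal to the volume of the ball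
for small `t`, but zero at `t = 1`.
-/

/-! ### Polynomial dependence of a determinant on a parameter -/

/-- The value at `1` of a real polynomial of degree at most `n` is a fixed linear combination of its
values at any `n + 1` distinct nodes. -/
theorem Polynomial.exists_weights_eval_one {n : ℕ} {v : ℕ → ℝ} (hv : Function.Injective v) :
    ∃ w : ℕ → ℝ, ∀ p : Polynomial ℝ, p.natDegree ≤ n →
      p.eval 1 = ∑ i ∈ Finset.range (n + 1), w i * p.eval (v i) := by
  refine ⟨fun i => (Lagrange.basis (Finset.range (n + 1)) v i).eval 1, fun p hp => ?_⟩
  have h := Lagrange.eq_interpolate (s := Finset.range (n + 1)) (v := v) (f := p) hv.injOn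
    (by
      rw [Finset.card_range]
      exact (Polynomial.degree_le_of_natDegree_le hp).trans_lt (by exact_mod_cast n.lt_succ_self))
  conv_lhs => rw [h]
  rw [Lagrange.interpolate_apply, Polynomial.eval_finsetSum]
  refine Finset.sum_congr rfl fun i _ => ?_
  rw [Polynomial.eval_mul, Polynomial.eval_C, mul_comm]

section Det

variable {E : Type*} [NormedAddCommGroup E] [NormedSpace ℝ E] [FiniteDimensional ℝ E]

theorem ContinuousLinearMap.exists_polynomial_det_one_add_smul (A : E →L[ℝ] E) :
    ∃ p : Polynomial ℝ, p.natDegree ≤ Module.finrank ℝ E ∧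
      ∀ t : ℝ, p.eval t = (1 + t • A).det := by
  let b := Module.finBasis ℝ E
  let M := LinearMap.toMatrix b b (A : E →ₗ[ℝ] E)
  refine ⟨((Polynomial.X : Polynomial ℝ) • M.map Polynomial.C
    + (1 : Matrix _ _ ℝ).map Polynomial.C).det, ?_, fun t => ?_⟩
  · simpa using Polynomial.natDegree_det_X_add_C_le M 1
  · rw [← Polynomial.coe_evalRingHom, RingHom.map_det]
    change _ = LinearMap.det ((1 + t • A : E →L[ℝ] E) : E →ₗ[ℝ] E)
    rw [← LinearMap.det_toMatrix b]
    congr 1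
    ext i j
    have h1 : LinearMap.toMatrix b b ((1 + t • A : E →L[ℝ] E) : E →ₗ[ℝ] E) = 1 + t • M := by
      rw [← LinearMap.toMatrix_one b, ← map_smul, ← map_add]
      rfl
    rw [h1]
    by_cases hij : i = j <;> simp [hij] <;> ring

theorem ContinuousLinearMap.det_one_add_pos {A : E →L[ℝ] E} (hA : ‖A‖ < 1) :
    0 < (1 + A).det := by
  have hne : ∀ s ∈ Set.Icc (0 : ℝ) 1, (1 + s • A).det ≠ 0 := by
    intro s hs h0
    have hlt : ‖-(s • A)‖ < 1 := by
      rw [norm_neg, norm_smul, Real.norm_of_nonneg hs.1]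
      exact (mul_le_of_le_one_left (norm_nonneg _) hs.2).trans_lt hA
    obtain ⟨y, hy⟩ := isUnit_one_sub_of_norm_lt_one hlt
    rw [sub_neg_eq_add] at hy
    have h2 : (1 + s • A).det * (↑y⁻¹ : E →L[ℝ] E).det = 1 := by
      rw [← hy]
      change LinearMap.det _ * LinearMap.det _ = 1
      rw [← LinearMap.det_comp]
      change LinearMap.det (((y : E →L[ℝ] E) * (↑y⁻¹ : E →L[ℝ] E) : E →L[ℝ] E) : E →ₗ[ℝ] E) = 1
      rw [Units.mul_inv]
      exact LinearMap.det_id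
    rw [h0, zero_mul] at h2
    exact zero_ne_one h2
  have hcont : Continuous fun s : ℝ => (1 + s • A).det :=
    ContinuousLinearMap.continuous_det.comp (by fun_prop)
  by_contra hle
  have h0 : (0 : ℝ) ∈ Set.Icc ((1 + (1 : ℝ) • A).det) ((1 + (0 : ℝ) • A).det) := by
    refine ⟨by simpa using hle, ?_⟩
    rw [zero_smul, add_zero]
    change 0 ≤ LinearMap.det (LinearMap.id : E →ₗ[ℝ] E)
    rw [LinearMap.det_id]
    exact zero_le_one
  obtain ⟨s, hs, hs0⟩ := intermediate_value_Icc' zero_le_one hcont.continuousOn h0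
  exact hne s hs hs0

/-- The determinant at `1 + A` is a fixed linear combination of the determinants at `1 + tᵢ A`,
for distinct `tᵢ` as small as desired: a polynomial is determined by its values near `0`. -/
theorem ContinuousLinearMap.exists_weights_det_one_add (E : Type*) [NormedAddCommGroup E]
    [NormedSpace ℝ E] [FiniteDimensional ℝ E] {ε : ℝ} (hε : 0 < ε) :
    ∃ (s : Finset ℕ) (w t : ℕ → ℝ), (∀ i, t i ∈ Set.Ioo 0 ε) ∧
      ∀ A : E →L[ℝ] E, (1 + A).det = ∑ i ∈ s, w i * (1 + t i • A).det := by
  have hinj : Function.Injective fun i : ℕ => ε / (i + 2) := by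
    intro i j h
    have hi : (0 : ℝ) < i + 2 := by positivity
    have hj : (0 : ℝ) < j + 2 := by positivity
    simp only at h
    rw [div_eq_div_iff hi.ne' hj.ne'] at h
    have := mul_left_cancel₀ hε.ne' h
    exact_mod_cast (add_right_cancel this).symm
  obtain ⟨w, hw⟩ := Polynomial.exists_weights_eval_one (n := Module.finrank ℝ E) hinj
  refine ⟨Finset.range (Module.finrank ℝ E + 1), w, fun i => ε / (i + 2), fun i => ⟨by positivity,
    div_lt_self hε (by linarith [(Nat.cast_nonneg i : (0 : ℝ) ≤ i)])⟩, fun A => ?_⟩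
  obtain ⟨p, hp, hpe⟩ := A.exists_polynomial_det_one_add_smul
  have := hw p hp
  simp only [hpe, one_smul] at this
  exact this

end Det

/-! ### There is no continuously differentiable retraction of a ball onto its sphere -/

section Retraction

open Metric Set MeasureTheory

variable {E : Type*} [NormedAddCommGroup E]

/-- A Lipschitz map on the closed unit ball that vanishes on the sphere remains Lipschitz, with the
same constant, when it is extended by zero. -/
theorem LipschitzOnWith.lipschitzWith_indicator_closedBall [NormedSpace ℝ E] {K : NNReal}
    {u : E → E} (hu : LipschitzOnWith K u (closedBall 0 1)) (h0 : ∀ x ∈ sphere (0 : E) 1, u x = 0) :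
    LipschitzWith K ((closedBall (0 : E) 1).indicator u) := by
  have key : ∀ x ∈ closedBall (0 : E) 1, ∀ y ∉ closedBall (0 : E) 1, ‖u x‖ ≤ K * ‖x - y‖ := by
    intro x hx y hy
    rw [mem_closedBall_zero_iff] at hx hy
    have hc : Continuous fun s : ℝ => ‖x + s • (y - x)‖ := by fun_prop
    obtain ⟨s, hs, hs1⟩ := intermediate_value_Icc zero_le_one hc.continuousOn
      (show (1 : ℝ) ∈ _ from ⟨by simpa using hx, by simpa using (not_le.1 hy).le⟩)
    have hz : x + s • (y - x) ∈ sphere (0 : E) 1 := by simpa using hs1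
    have h := hu.norm_sub_le (mem_closedBall_zero_iff.2 hx) (sphere_subset_closedBall hz)
    rw [h0 _ hz, sub_zero] at h
    refine h.trans (mul_le_mul_of_nonneg_left ?_ K.2)
    rw [show x - (x + s • (y - x)) = s • (x - y) by
      rw [smul_sub, smul_sub]; abel, norm_smul, Real.norm_of_nonneg hs.1]
    exact mul_le_of_le_one_left (norm_nonneg _) hs.2
  refine lipschitzWith_iff_norm_sub_le.2 fun x y => ?_
  by_cases hx : x ∈ closedBall (0 : E) 1 <;> by_cases hy : y ∈ closedBall (0 : E) 1
  · simpa [indicator_of_mem hx, indicator_of_mem hy] using hu.norm_sub_le hx hy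
  · simpa [indicator_of_mem hx, indicator_of_notMem hy] using key x hx y hy
  · simpa [indicator_of_notMem hx, indicator_of_mem hy, norm_sub_rev x y] using key y hy x hx
  · simpa [indicator_of_notMem hx, indicator_of_notMem hy] using
      mul_nonneg K.2 (norm_nonneg (x - y))

/-- A small perturbation of the identity that fixes the sphere and does not enlarge the ball
permutes the open unit ball. -/
theorem bijOn_ball_add_smul [NormedSpace ℝ E] [CompleteSpace E] {K : NNReal} {u : E → E}
    (hu : LipschitzOnWith K u (closedBall 0 1)) (h0 : ∀ x ∈ sphere (0 : E) 1, u x = 0)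
    (hball : ∀ x ∈ closedBall (0 : E) 1, ‖x + u x‖ ≤ 1) {t : ℝ} (ht : t ∈ Ioo 0 1)
    (htK : t * K < 1) : BijOn (fun x => x + t • u x) (ball 0 1) (ball 0 1) := by
  set v := (closedBall (0 : E) 1).indicator u
  have hv : LipschitzWith K v := hu.lipschitzWith_indicator_closedBall h0
  have hvu : ∀ x ∈ closedBall (0 : E) 1, v x = u x := fun x hx => indicator_of_mem hx u
  refine ⟨fun x hx => ?_, fun x hx y hy hxy => ?_, fun y hy => ?_⟩
  · have h1 := hball x (ball_subset_closedBall hx)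
    rw [mem_ball_zero_iff] at hx ⊢
    calc ‖x + t • u x‖ = ‖(1 - t) • x + t • (x + u x)‖ := by
          congr 1; rw [sub_smul, one_smul, smul_add]; abel
      _ ≤ (1 - t) * ‖x‖ + t * ‖x + u x‖ := by
          refine (norm_add_le _ _).trans ?_
          rw [norm_smul, norm_smul, Real.norm_of_nonneg ht.1.le,
            Real.norm_of_nonneg (sub_nonneg.2 ht.2.le)]
      _ < 1 := by nlinarith [ht.1, ht.2]
  · have h := hu.norm_sub_le (ball_subset_closedBall hx) (ball_subset_closedBall hy)
    have h2 : x - y = t • (u y - u x) := by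
      rw [smul_sub]
      exact sub_eq_sub_iff_add_eq_add.2 (by simpa [add_comm] using hxy)
    have h3 : ‖x - y‖ ≤ t * K * ‖x - y‖ := by
      conv_lhs => rw [h2, norm_smul, Real.norm_of_nonneg ht.1.le, norm_sub_rev]
      rw [mul_assoc]
      exact mul_le_mul_of_nonneg_left h ht.1.le
    have h4 : ‖x - y‖ ≤ 0 := by
      by_contra h5
      nlinarith [not_le.1 h5]
    exact sub_eq_zero.1 (norm_le_zero_iff.1 h4)
  · have hc : ContractingWith (Real.toNNReal t * K) fun x => y - t • v x := by
      refine ⟨?_, lipschitzWith_iff_norm_sub_le.2 fun a b => ?_⟩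
      · rw [← NNReal.coe_lt_coe]
        simpa [ht.1.le] using htK
      · rw [sub_sub_sub_cancel_left, ← smul_sub, norm_smul, Real.norm_of_nonneg ht.1.le,
          norm_sub_rev a b, NNReal.coe_mul, Real.coe_toNNReal _ ht.1.le, mul_assoc]
        exact mul_le_mul_of_nonneg_left (hv.norm_sub_le b a) ht.1.le
    have : Nonempty E := ⟨0⟩
    have hfix : y - t • v (hc.fixedPoint) = hc.fixedPoint := hc.fixedPoint_isFixedPt
    set x := hc.fixedPoint
    have hxy : x + t • v x = y := by rw [← sub_eq_iff_eq_add.1 hfix]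
    have hx : x ∈ closedBall (0 : E) 1 := by
      by_contra hx
      rw [show v x = 0 from indicator_of_notMem hx u, smul_zero, add_zero] at hxy
      exact hx (hxy ▸ ball_subset_closedBall hy)
    rw [hvu x hx] at hxy
    refine ⟨x, ?_, hxy⟩
    rcases (mem_closedBall_zero_iff.1 hx).lt_or_eq with h | h
    · exact mem_ball_zero_iff.2 h
    · rw [h0 x (mem_sphere_zero_iff_norm.2 h), smul_zero, add_zero] at hxy
      exact hxy ▸ hy

variable [InnerProductSpace ℝ E]

/-- The derivative of a map into the sphere takes values in a hyperplane. -/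
theorem det_eq_zero_of_norm_eq_one [FiniteDimensional ℝ E] {r : E → E} {r' : E →L[ℝ] E} {x : E}
    {s : Set E} (hs : s ∈ nhds x) (hr : HasFDerivAt r r' x) (h1 : ∀ y ∈ s, ‖r y‖ = 1) :
    r'.det = 0 := by
  have hz : ∀ w, inner ℝ (r x) (r' w) = 0 := by
    intro w
    have hd := (hr.norm_sq).unique
      ((hasFDerivAt_const (1 : ℝ) x).congr_of_eventuallyEq
        (Filter.mem_of_superset hs fun y hy => by simp [h1 y hy]))
    have := congrArg (fun l : E →L[ℝ] ℝ => l w) hd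
    simpa using this
  by_contra hdet
  have hsurj : Function.Surjective r' := by
    have hu : IsUnit (LinearMap.det (r' : E →ₗ[ℝ] E)) := isUnit_iff_ne_zero.2 hdet
    exact ((Module.End.isUnit_iff _).1 ((LinearMap.isUnit_iff_isUnit_det _).2 hu)).2
  obtain ⟨w, hw⟩ := hsurj (r x)
  have := hz w
  rw [hw, real_inner_self_eq_norm_sq, h1 x (mem_of_mem_nhds hs)] at this
  norm_num at this

/-- If `r` were such a retraction, the maps `x + t (r x - x)` would permute the ball for small
`t`, so that the integral over the ball of their Jacobian, a polynomial in `t`, would be constantly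
the volume of the ball. At `t = 1` the Jacobian is that of `r`, which vanishes. -/
theorem not_exists_contDiff_retraction_sphere [FiniteDimensional ℝ E] {r : E → E}
    (hr : ∀ x ∈ closedBall (0 : E) 1, ContDiffAt ℝ 1 r x)
    (hr1 : ∀ x ∈ closedBall (0 : E) 1, ‖r x‖ = 1) (hrid : ∀ x ∈ sphere (0 : E) 1, r x = x) :
    False := by
  borelize E
  set u : E → E := fun x => r x - x with hu_def
  have hu : ∀ x ∈ closedBall (0 : E) 1, ContDiffAt ℝ 1 u x := fun x hx =>
    (hr x hx).sub contDiffAt_id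
  have hu0 : ∀ x ∈ sphere (0 : E) 1, u x = 0 := fun x hx => sub_eq_zero.2 (hrid x hx)
  obtain ⟨K, hK⟩ := ContDiffOn.exists_lipschitzOnWith (n := 1)
    (fun x hx => (hu x hx).contDiffWithinAt) one_ne_zero (convex_closedBall (0 : E) 1)
    (isCompact_closedBall (0 : E) 1)
  have hDu : ∀ x ∈ ball (0 : E) 1, HasFDerivAt u (fderiv ℝ u x) x := fun x hx =>
    ((hu x (ball_subset_closedBall hx)).differentiableAt one_ne_zero).hasFDerivAt
  have hDuK : ∀ x ∈ ball (0 : E) 1, ‖fderiv ℝ u x‖ ≤ K := fun x hx =>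
    norm_fderiv_le_of_lipschitzOn ℝ (Filter.mem_of_superset (isOpen_ball.mem_nhds hx)
      ball_subset_closedBall) hK
  have hcont : ContinuousOn (fderiv ℝ u) (closedBall 0 1) := fun x hx =>
    ((hu x hx).fderiv_right (m := 0) (by norm_num)).continuousAt.continuousWithinAt
  have hint : ∀ t : ℝ, IntegrableOn (fun x => (1 + t • fderiv ℝ u x).det) (ball (0 : E) 1) :=
    fun t => ((ContinuousLinearMap.continuous_det.comp_continuousOn
      (continuousOn_const.add (hcont.const_smul t))).integrableOn_compact
        (isCompact_closedBall 0 1)).mono_set ball_subset_closedBall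
  have hsmall : ∀ t ∈ Ioo (0 : ℝ) (1 / (K + 1)),
      ∫ x in ball (0 : E) 1, (1 + t • fderiv ℝ u x).det = volume.real (ball (0 : E) 1) := by
    intro t ht
    have hK0 : (0 : ℝ) ≤ K := K.2
    have htK' : t * (K + 1) < 1 := by
      rw [← lt_div_iff₀ (by positivity)]; exact ht.2
    have htK : t * K < 1 := by nlinarith [ht.1]
    have ht1 : t < 1 := by nlinarith [ht.1, mul_nonneg ht.1.le hK0]
    have hbij := bijOn_ball_add_smul hK hu0
      (fun x hx => by rw [hu_def]; simp [hr1 x hx]) ⟨ht.1, ht1⟩ htK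
    have hchange := lintegral_abs_det_fderiv_eq_addHaar_image (volume : Measure E)
      (f := fun x => x + t • u x) (f' := fun x => 1 + t • fderiv ℝ u x)
      measurableSet_ball (fun x hx => ((hasFDerivAt_id x).add
        ((hDu x hx).const_smul t)).hasFDerivWithinAt) hbij.injOn
    rw [hbij.image_eq] at hchange
    have hpos : ∀ x ∈ ball (0 : E) 1, 0 < (1 + t • fderiv ℝ u x).det := fun x hx => by
      refine ContinuousLinearMap.det_one_add_pos ?_
      rw [norm_smul, Real.norm_of_nonneg ht.1.le]
      exact (mul_le_mul_of_nonneg_left (hDuK x hx) ht.1.le).trans_lt htK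
    rw [integral_eq_lintegral_of_nonneg_ae
      ((ae_restrict_iff' measurableSet_ball).2 (Filter.Eventually.of_forall
        fun x hx => (hpos x hx).le)) (hint t).aestronglyMeasurable, Measure.real, ← hchange]
    congr 1
    exact setLIntegral_congr_fun measurableSet_ball fun x hx => by
      simp only [abs_of_pos (hpos x hx)]
  obtain ⟨s, w, t, ht, hw⟩ := ContinuousLinearMap.exists_weights_det_one_add E
    (show (0 : ℝ) < 1 / (K + 1) by positivity)
  have hw1 : ∑ i ∈ s, w i = 1 := by
    have hone : (1 : E →L[ℝ] E).det = 1 := LinearMap.det_id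
    have := hw 0
    simp only [smul_zero, add_zero, hone, mul_one] at this
    exact this.symm
  have hvol : ∫ x in ball (0 : E) 1, (1 + fderiv ℝ u x).det = volume.real (ball (0 : E) 1) := by
    rw [integral_congr_ae (Filter.Eventually.of_forall fun x => hw (fderiv ℝ u x)),
      integral_finsetSum _ fun i _ => (hint (t i)).const_mul (w i)]
    rw [Finset.sum_congr rfl fun i _ => (integral_const_mul (w i) _).trans
      (congrArg (w i * ·) (hsmall (t i) (ht i))), ← Finset.sum_mul, hw1, one_mul]
  have hzero : ∫ x in ball (0 : E) 1, (1 + fderiv ℝ u x).det = 0 := by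
    refine setIntegral_eq_zero_of_forall_eq_zero fun x hx => ?_
    refine det_eq_zero_of_norm_eq_one (r := r)
      (Filter.mem_of_superset (isOpen_ball.mem_nhds hx) ball_subset_closedBall) ?_ hr1
    have h := (hasFDerivAt_id x).add (hDu x hx)
    rwa [show id + u = r from funext fun y => add_sub_cancel y (r y)] at h
  have hpos : 0 < volume.real (ball (0 : E) 1) :=
    ENNReal.toReal_pos (measure_ball_pos volume 0 one_pos).ne' measure_ball_lt_top.ne
  exact hpos.ne' (hvol.symm.trans hzero)

end Retraction

/-! ### The fixed point theorem of Brouwer -/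

section Brouwer

open Metric Set

variable {E : Type*} [NormedAddCommGroup E] [InnerProductSpace ℝ E] [FiniteDimensional ℝ E]

/-- Brouwer's theorem for a continuously differentiable map `f`: without a fixed point, sending `x`
to the point where the ray from `f x` through `x` leaves the ball would be a retraction of the ball
onto its sphere. -/
theorem exists_fixedPoint_closedBall_of_contDiff {f : E → E} (hf : ContDiff ℝ 1 f)
    (hmaps : MapsTo f (closedBall 0 1) (closedBall 0 1)) :
    ∃ x ∈ closedBall (0 : E) 1, f x = x := by
  by_contra! hne
  -- `x + s • (x - f x)` has norm one when `a * s ^ 2 + 2 * b * s + c = 0`;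
  -- `s` is the larger root of this equation.
  let a : E → ℝ := fun x => ‖x - f x‖ ^ 2
  let b : E → ℝ := fun x => inner ℝ x (x - f x)
  let c : E → ℝ := fun x => ‖x‖ ^ 2 - 1
  let s : E → ℝ := fun x => (-b x + √(b x ^ 2 - a x * c x)) / a x
  have ha : ∀ x ∈ closedBall (0 : E) 1, 0 < a x := fun x hx =>
    pow_pos (norm_pos_iff.2 (sub_ne_zero.2 (hne x hx).symm)) 2
  have hb : ∀ x ∈ sphere (0 : E) 1, 0 < b x := by
    intro x hx
    have hx1 : ‖x‖ = 1 := mem_sphere_zero_iff_norm.1 hx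
    have hfx : ‖f x‖ ≤ 1 := mem_closedBall_zero_iff.1 (hmaps (sphere_subset_closedBall hx))
    have h1 := ha x (sphere_subset_closedBall hx)
    have h2 : a x = 1 - 2 * inner ℝ x (f x) + ‖f x‖ ^ 2 := by
      simp only [a]
      rw [norm_sub_sq_real, hx1]
      norm_num
    have h3 : b x = 1 - inner ℝ x (f x) := by
      simp only [b]
      rw [inner_sub_right, real_inner_self_eq_norm_sq, hx1]
      norm_num
    have h4 : ‖f x‖ ^ 2 ≤ 1 := pow_le_one₀ (norm_nonneg _) hfx
    linarith
  have hD : ∀ x ∈ closedBall (0 : E) 1, 0 < b x ^ 2 - a x * c x := by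
    intro x hx
    rcases (mem_closedBall_zero_iff.1 hx).lt_or_eq with h | h
    · have hc : c x < 0 := by
        have := pow_lt_one₀ (norm_nonneg x) h two_ne_zero
        simp only [c]; linarith
      have := mul_pos (ha x hx) (neg_pos.2 hc)
      nlinarith [sq_nonneg (b x)]
    · have hc : c x = 0 := by simp [c, h]
      have := pow_pos (hb x (mem_sphere_zero_iff_norm.2 h)) 2
      rw [hc]; linarith
  refine not_exists_contDiff_retraction_sphere (r := fun x => x + s x • (x - f x)) ?_ ?_ ?_
  · intro x hx
    have hd : ContDiffAt ℝ 1 (fun x => x - f x) x := contDiffAt_id.sub hf.contDiffAt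
    have hb' : ContDiffAt ℝ 1 b x := contDiffAt_id.inner ℝ hd
    have ha' : ContDiffAt ℝ 1 a x := hd.norm_sq ℝ
    have hc' : ContDiffAt ℝ 1 c x := (contDiffAt_id.norm_sq ℝ).sub contDiffAt_const
    have hs : ContDiffAt ℝ 1 s x := ((hb'.neg).add
      (((hb'.pow 2).sub (ha'.mul hc')).sqrt (hD x hx).ne')).div ha' (ha x hx).ne'
    exact contDiffAt_id.add (hs.smul hd)
  · intro x hx
    have hsa : s x * a x + b x = √(b x ^ 2 - a x * c x) := by
      simp only [s]
      rw [div_mul_cancel₀ _ (ha x hx).ne']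
      ring
    have hroot : c x + 2 * s x * b x + s x ^ 2 * a x = 0 := by
      have hsq := Real.sq_sqrt (hD x hx).le
      rw [← hsa] at hsq
      have h0 : a x * (c x + 2 * s x * b x + s x ^ 2 * a x) = 0 := by linear_combination hsq
      exact (mul_eq_zero.1 h0).resolve_left (ha x hx).ne'
    have hsq : ‖x + s x • (x - f x)‖ ^ 2 = 1 := by
      rw [norm_add_sq_real, inner_smul_right, norm_smul, mul_pow, Real.norm_eq_abs, sq_abs]
      have : c x = ‖x‖ ^ 2 - 1 := rfl
      have hb' : b x = inner ℝ x (x - f x) := rfl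
      have ha' : a x = ‖x - f x‖ ^ 2 := rfl
      rw [← hb', ← ha']
      linarith
    exact (pow_eq_one_iff_of_nonneg (norm_nonneg _) two_ne_zero).1 hsq
  · intro x hx
    have hc : c x = 0 := by simp [c, mem_sphere_zero_iff_norm.1 hx]
    have hs : s x = 0 := by
      simp only [s]
      rw [hc, mul_zero, sub_zero, Real.sqrt_sq (hb x hx).le, neg_add_cancel, zero_div]
    simp [hs]

theorem exists_fixedPoint_closedBall {f : E → E} (hf : Continuous f)
    (hmaps : MapsTo f (closedBall 0 1) (closedBall 0 1)) :
    ∃ x ∈ closedBall (0 : E) 1, f x = x := by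
  by_contra! hne
  obtain ⟨x₀, hx₀, hmin⟩ := (isCompact_closedBall (0 : E) 1).exists_isMinOn
    (nonempty_closedBall.2 zero_le_one)
    (f := fun x => ‖f x - x‖) (by fun_prop)
  obtain ⟨ε, hε0, hε⟩ : ∃ ε > 0, ∀ x ∈ closedBall (0 : E) 1, ε + ε ≤ ‖f x - x‖ := by
    refine ⟨‖f x₀ - x₀‖ / 2, half_pos (norm_pos_iff.2 (sub_ne_zero.2 (hne x₀ hx₀))), fun x hx => ?_⟩
    rw [add_halves]
    exact hmin hx
  have huc : UniformContinuousOn f (cthickening 1 (closedBall (0 : E) 1)) :=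
    (isCompact_closedBall (0 : E) 1).cthickening.uniformContinuousOn_of_continuous hf.continuousOn
  obtain ⟨δ, hδ, hfδ⟩ := Metric.uniformContinuousOn_iff.1 huc (ε / 2) (half_pos hε0)
  obtain ⟨g, hg, hgf⟩ := hf.exists_contDiff_dist_le_of_forall_mem_ball_dist_le (lt_min one_pos hδ)
  have hgf' : ∀ x ∈ closedBall (0 : E) 1, ‖g x - f x‖ < ε := by
    intro x hx
    rw [← dist_eq_norm]
    refine (hgf x _ fun y hy => ?_).trans_lt (half_lt_self hε0)
    rw [mem_ball, lt_min_iff] at hy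
    exact (hfδ _ (mem_cthickening_of_dist_le _ x _ _ hx hy.1.le) _
      (self_subset_cthickening _ hx) hy.2).le
  have hε1 : 0 < 1 + ε := by linarith
  have hgle : ∀ x ∈ closedBall (0 : E) 1, ‖g x‖ ≤ 1 + ε := by
    intro x hx
    have h1 := mem_closedBall_zero_iff.1 (hmaps hx)
    have h2 := norm_le_norm_add_norm_sub' (g x) (f x)
    linarith [hgf' x hx]
  -- The smooth approximation is shrunk so that it maps the ball to itself.
  obtain ⟨x, hx, hfix⟩ := exists_fixedPoint_closedBall_of_contDiff
    (f := fun x => (1 + ε)⁻¹ • g x) ((hg.of_le (by exact_mod_cast le_top)).const_smul _) (by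
      intro x hx
      rw [mem_closedBall_zero_iff, norm_smul, Real.norm_of_nonneg (inv_nonneg.2 hε1.le),
        inv_mul_le_one₀ hε1]
      exact hgle x hx)
  have hgx : g x = (1 + ε) • x := (inv_smul_eq_iff₀ hε1.ne').1 hfix
  have h1 : ‖g x - x‖ ≤ ε := by
    rw [hgx, add_smul, one_smul, add_sub_cancel_left, norm_smul, Real.norm_of_nonneg hε0.le]
    exact mul_le_of_le_one_right hε0.le (mem_closedBall_zero_iff.1 hx)
  have h2 := norm_sub_le_norm_sub_add_norm_sub (f x) (g x) x
  rw [norm_sub_rev (f x) (g x)] at h2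
  linarith [hε x hx, hgf' x hx]

variable {ι : Type*} [Fintype ι]

/-- A continuous retraction of `ι → ℝ` onto the standard simplex, which takes positive parts,
raises their sum to at least one by an equal share to every coordinate, and normalizes. -/
noncomputable def simplexRetraction (x : ι → ℝ) : ι → ℝ := fun i =>
  (max (x i) 0 + max (1 - ∑ j, max (x j) 0) 0 / Fintype.card ι) / max 1 (∑ j, max (x j) 0)

theorem continuous_simplexRetraction : Continuous (simplexRetraction (ι := ι)) := by
  refine continuous_pi fun i => Continuous.div (by fun_prop) (by fun_prop) fun x => ?_
  exact (lt_max_of_lt_left one_pos).ne'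

theorem simplexRetraction_mem [Nonempty ι] (x : ι → ℝ) : simplexRetraction x ∈ stdSimplex ℝ ι := by
  have h0 : (0 : ℝ) < max 1 (∑ j, max (x j) 0) := lt_max_of_lt_left one_pos
  refine ⟨fun i => div_nonneg (add_nonneg (le_max_right _ _)
    (div_nonneg (le_max_right _ _) (Nat.cast_nonneg _))) h0.le, ?_⟩
  simp only [simplexRetraction]
  rw [← Finset.sum_div, div_eq_one_iff_eq h0.ne', Finset.sum_add_distrib, Finset.sum_const,
    Finset.card_univ, nsmul_eq_mul, mul_div_cancel₀ _ (Nat.cast_ne_zero.2 Fintype.card_ne_zero),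
    ← max_add_add_left]
  simp

theorem simplexRetraction_of_mem {x : ι → ℝ} (hx : x ∈ stdSimplex ℝ ι) :
    simplexRetraction x = x := by
  have h : ∀ i, max (x i) 0 = x i := fun i => max_eq_left (hx.1 i)
  funext i
  simp [simplexRetraction, h, hx.2]

theorem norm_toLp_le_one_of_mem_stdSimplex {x : ι → ℝ} (hx : x ∈ stdSimplex ℝ ι) :
    ‖(WithLp.toLp 2 x : EuclideanSpace ℝ ι)‖ ≤ 1 := by
  rw [← sq_le_one_iff₀ (norm_nonneg _), EuclideanSpace.real_norm_sq_eq, ← hx.2]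
  refine Finset.sum_le_sum fun i _ => ?_
  have h1 : x i ≤ 1 := hx.2 ▸ Finset.single_le_sum (fun j _ => hx.1 j) (Finset.mem_univ i)
  have h0 := hx.1 i
  change x i ^ 2 ≤ x i
  nlinarith

theorem exists_fixedPoint_stdSimplex [Nonempty ι] {f : (ι → ℝ) → ι → ℝ}
    (hf : ContinuousOn f (stdSimplex ℝ ι)) (hmaps : MapsTo f (stdSimplex ℝ ι) (stdSimplex ℝ ι)) :
    ∃ x ∈ stdSimplex ℝ ι, f x = x := by
  have hcont : Continuous fun x : ι → ℝ => f (simplexRetraction x) :=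
    hf.comp_continuous continuous_simplexRetraction simplexRetraction_mem
  obtain ⟨x, -, hx⟩ := exists_fixedPoint_closedBall (E := EuclideanSpace ℝ ι)
    (f := fun x => WithLp.toLp 2 (f (simplexRetraction x.ofLp)))
    ((PiLp.continuous_toLp 2 _).comp (hcont.comp (PiLp.continuous_ofLp 2 _)))
    (fun x _ => mem_closedBall_zero_iff.2
      (norm_toLp_le_one_of_mem_stdSimplex (hmaps (simplexRetraction_mem _))))
  have hx' : f (simplexRetraction x.ofLp) = x.ofLp := congrArg WithLp.ofLp hx
  have hmem : x.ofLp ∈ stdSimplex ℝ ι := hx' ▸ hmaps (simplexRetraction_mem _)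
  exact ⟨x.ofLp, hmem, by rwa [simplexRetraction_of_mem hmem] at hx'⟩

end Brouwer

/-! ### The inequality of Ky Fan -/

section KyFan

variable {V : Type*} [AddCommGroup V] [Module ℝ V] [TopologicalSpace V] [ContinuousAdd V]
  [ContinuousSMul ℝ V] {K : Set V} {φ : V → V → ℝ}

/-- The inequality of Ky Fan against finitely many deviations `w i`. The fixed point is that of the
map by which Nash proved the existence of equilibria: it shifts the weight of a convex combination
of the `w i` towards those with `0 < φ z (w i)`. -/
theorem exists_forall_finite_le_zero {ι : Type*} [Fintype ι] [Nonempty ι] (hK : Convex ℝ K)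
    (hcont : ∀ w ∈ K, ContinuousOn (fun z => φ z w) K) (hconc : ∀ z ∈ K, ConcaveOn ℝ K (φ z))
    (hdiag : ∀ z ∈ K, φ z z ≤ 0) (w : ι → V) (hw : ∀ i, w i ∈ K) :
    ∃ z ∈ K, ∀ i, φ z (w i) ≤ 0 := by
  let z : (ι → ℝ) → V := fun l => ∑ i, l i • w i
  have hz : ∀ l ∈ stdSimplex ℝ ι, z l ∈ K := fun l hl =>
    hK.sum_mem (fun i _ => hl.1 i) hl.2 fun i _ => hw i
  have hzc : Continuous z := by fun_prop
  let g : ι → (ι → ℝ) → ℝ := fun i l => max (φ (z l) (w i)) 0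
  have hg0 : ∀ i l, 0 ≤ g i l := fun i l => le_max_right _ _
  have hS0 : ∀ l, 0 ≤ ∑ i, g i l := fun l => Finset.sum_nonneg fun i _ => hg0 i l
  have hS1 : ∀ l, 0 < 1 + ∑ i, g i l := fun l => add_pos_of_pos_of_nonneg one_pos (hS0 l)
  have hgc : ∀ i, ContinuousOn (g i) (stdSimplex ℝ ι) := fun i =>
    ((hcont _ (hw i)).comp hzc.continuousOn hz).sup continuousOn_const
  obtain ⟨l, hl, hfix⟩ := exists_fixedPoint_stdSimplex
    (f := fun l i => (l i + g i l) / (1 + ∑ j, g j l))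
    (continuousOn_pi.2 fun i => ContinuousOn.div
      ((continuous_apply i).continuousOn.add (hgc i))
      (continuousOn_const.add (continuousOn_finsetSum _ fun j _ => hgc j)) fun l _ => (hS1 l).ne')
    (fun l hl => ⟨fun i => div_nonneg (add_nonneg (hl.1 i) (hg0 i l)) (hS1 l).le, by
      rw [← Finset.sum_div, Finset.sum_add_distrib, hl.2, div_self (hS1 l).ne']⟩)
  have hgi : ∀ i, g i l = l i * ∑ j, g j l := by
    intro i
    have h := congrFun hfix i
    rw [div_eq_iff (hS1 l).ne'] at h
    linarith
  refine ⟨z l, hz l hl, fun i => ?_⟩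
  rcases (hS0 l).eq_or_lt with h | h
  · have := hgi i
    rw [← h, mul_zero] at this
    exact (le_max_left _ _).trans this.le
  · exfalso
    have hpos : ∀ i, 0 < l i → 0 < φ (z l) (w i) := by
      intro i hi
      have : 0 < g i l := hgi i ▸ mul_pos hi h
      simpa [g] using this
    have hnn : ∀ i, 0 ≤ l i * φ (z l) (w i) := fun i => by
      rcases (hl.1 i).eq_or_lt with h0 | h0
      · rw [← h0, zero_mul]
      · exact (mul_pos h0 (hpos i h0)).le
    obtain ⟨i, hi⟩ : ∃ i, 0 < l i := by
      by_contra! hle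
      have := Finset.sum_nonpos fun i (_ : i ∈ Finset.univ) => hle i
      rw [hl.2] at this
      exact absurd this (not_le.2 one_pos)
    have hsum : 0 < ∑ i, l i * φ (z l) (w i) :=
      Finset.sum_pos' (fun i _ => hnn i) ⟨i, Finset.mem_univ i, mul_pos hi (hpos i hi)⟩
    have hj := (hconc _ (hz l hl)).le_map_sum (fun i _ => hl.1 i) hl.2 (fun i _ => hw i)
      (t := Finset.univ)
    exact absurd (hsum.trans_le (hj.trans (hdiag _ (hz l hl)))) (lt_irrefl _)

/-- The inequality of Ky Fan. -/
theorem IsCompact.exists_forall_le_zero (hKc : IsCompact K) (hne : K.Nonempty) (hK : Convex ℝ K)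
    (hcont : ∀ w ∈ K, ContinuousOn (fun z => φ z w) K) (hconc : ∀ z ∈ K, ConcaveOn ℝ K (φ z))
    (hdiag : ∀ z ∈ K, φ z z ≤ 0) : ∃ z ∈ K, ∀ w ∈ K, φ z w ≤ 0 := by
  have : CompactSpace K := isCompact_iff_compactSpace.1 hKc
  have hcl : ∀ w : K, IsClosed {z : K | φ z w ≤ 0} := fun w =>
    isClosed_le (continuousOn_iff_continuous_domRestrict.1 (hcont w w.2)) continuous_const
  obtain ⟨z, hz⟩ := CompactSpace.iInter_nonempty hcl fun s => by
    rcases s.eq_empty_or_nonempty with rfl | hs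
    · exact ⟨⟨hne.some, hne.some_mem⟩, by simp⟩
    · have : Nonempty s := hs.to_subtype
      obtain ⟨z, hz, h⟩ := exists_forall_finite_le_zero hK hcont hconc hdiag
        (fun i : s => ((i : K) : V)) fun i => (i : K).2
      exact ⟨⟨z, hz⟩, Set.mem_iInter₂.2 fun i hi => h ⟨i, hi⟩⟩
  exact ⟨z, z.2, fun w hw => Set.mem_iInter.1 hz ⟨w, hw⟩⟩

end KyFan

/-! ### The adversary's cost at one target node -/

theorem EReal.coe_sum {ι : Type*} (s : Finset ι) (f : ι → ℝ) :
    ((∑ i ∈ s, f i : ℝ) : EReal) = ∑ i ∈ s, (f i : EReal) :=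
  map_sum (⟨⟨fun x : ℝ => (x : EReal), EReal.coe_zero⟩, EReal.coe_add⟩ : ℝ →+ EReal) f s

theorem EReal.coe_ennreal_sum {ι : Type*} (s : Finset ι) (f : ι → ℝ≥0∞) :
    ((∑ i ∈ s, f i : ℝ≥0∞) : EReal) = ∑ i ∈ s, (f i : EReal) :=
  map_sum (⟨⟨fun x : ℝ≥0∞ => (x : EReal), EReal.coe_ennreal_zero⟩, EReal.coe_ennreal_add⟩ :
    ℝ≥0∞ →+ EReal) f s

namespace AdversarialOT

/-- The tangent line at `η` of the convex function `y ↦ y ^ (-b)` lies below it. -/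
theorem rpow_neg_tangent_le {b η y : ℝ} (hb : b ∈ Set.Icc (0 : ℝ) 1) (hη : 0 < η) (hy : 0 < y) :
    η ^ (-b) - b * η ^ (-b - 1) * (y - η) ≤ y ^ (-b) := by
  have hr : 0 < y / η := div_pos hy hη
  have h1 := rpow_one_add_le_one_add_mul_self (s := y / η - 1) (by linarith) hb.1 hb.2
  rw [add_sub_cancel] at h1
  have hpos : 0 < (y / η) ^ b := Real.rpow_pos_of_pos hr b
  have h2 : 1 - b * (y / η - 1) ≤ (y / η) ^ (-b) := by
    rw [Real.rpow_neg hr.le, ← one_div, le_div_iff₀ hpos]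
    nlinarith [sq_nonneg (b * (y / η - 1)), sq_nonneg ((y / η) ^ b - 1)]
  have h3 : y ^ (-b) = (y / η) ^ (-b) * η ^ (-b) := by
    rw [← Real.mul_rpow hr.le hη.le, div_mul_cancel₀ _ hη.ne']
  have h4 : η ^ (-b - 1) * (y - η) = η ^ (-b) * (y / η - 1) := by
    rw [Real.rpow_sub_one hη.ne']
    field_simp
  have h5 := mul_le_mul_of_nonneg_right h2 (Real.rpow_nonneg hη.le (-b))
  rw [mul_assoc, h4, h3]
  linarith

/-- A point `η` of `[0, n]` at which the derivative of `A η ^ (-b) + C η`, multiplied by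
`η ^ (1 + b)`, satisfies the variational inequality minimizes this cost over `[0, n]`. -/
theorem nodeCost_le_of_variationalInequality {A C M b n η y : ℝ} (hA : 0 ≤ A) (hC : 0 ≤ C)
    (hb : b ∈ Set.Icc (0 : ℝ) 1) (hη : η ∈ Set.Icc 0 n) (hy : y ∈ Set.Icc 0 n)
    (hvi : ∀ s ∈ Set.Icc 0 n, 0 ≤ (C * η ^ (1 + b) - b * A) * (s - η)) :
    ((ENNReal.ofReal A * ENNReal.ofReal η ^ (-b) : ℝ≥0∞) : EReal) + ((M + C * η : ℝ) : EReal) ≤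
      ((ENNReal.ofReal A * ENNReal.ofReal y ^ (-b) : ℝ≥0∞) : EReal)
        + ((M + C * y : ℝ) : EReal) := by
  have hn : 0 ≤ n := hy.1.trans hy.2
  rcases (mul_nonneg hb.1 hA).eq_or_lt with h0 | h0
  · -- The penalty does not depend on the action, and the variational inequality at `0` makes the
    -- linear term vanish.
    have hCη : C * η = 0 := by
      have h := hvi 0 ⟨le_rfl, hn⟩
      rw [← h0] at h
      rcases hη.1.eq_or_lt with h1 | h1
      · rw [← h1, mul_zero]
      · have := Real.rpow_pos_of_pos h1 (1 + b)
        have h2 : C * (η ^ (1 + b) * η) ≤ 0 := by linarith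
        have h3 : C ≤ 0 := nonpos_of_mul_nonpos_left h2 (mul_pos this h1)
        rw [le_antisymm h3 hC, zero_mul]
    refine add_le_add ?_ (EReal.coe_le_coe_iff.2 ?_)
    · rcases mul_eq_zero.1 h0.symm with h | h <;> simp [h]
    · rw [hCη]
      linarith [mul_nonneg hC hy.1]
  · have hb0 : 0 < b := pos_of_mul_pos_left h0 hA
    have hA0 : 0 < A := pos_of_mul_pos_right h0 hb.1
    rcases hy.1.eq_or_lt with hy0 | hy0
    · have htop : ENNReal.ofReal A * ENNReal.ofReal y ^ (-b) = ⊤ := by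
        rw [← hy0, ENNReal.ofReal_zero, ENNReal.zero_rpow_of_neg (neg_lt_zero.2 hb0),
          ENNReal.mul_top (ENNReal.ofReal_pos.2 hA0).ne']
      rw [htop, EReal.coe_ennreal_top, EReal.top_add_coe]
      exact le_top
    · have hη0 : 0 < η := by
        refine hη.1.lt_of_ne fun h => ?_
        have h1 := hvi y hy
        rw [← h, Real.zero_rpow (by linarith), mul_zero, zero_sub, sub_zero] at h1
        nlinarith [mul_pos h0 hy0]
      have hcoe : ∀ v : ℝ, 0 < v →
          ((ENNReal.ofReal A * ENNReal.ofReal v ^ (-b) : ℝ≥0∞) : EReal)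
            = ((A * v ^ (-b) : ℝ) : EReal) := by
        intro v hv
        rw [ENNReal.ofReal_rpow_of_pos hv, ← ENNReal.ofReal_mul hA, EReal.coe_ennreal_ofReal,
          max_eq_left (mul_nonneg hA (Real.rpow_nonneg hv.le _))]
      rw [hcoe η hη0, hcoe y hy0, ← EReal.coe_add, ← EReal.coe_add, EReal.coe_le_coe_iff]
      have h1 := mul_le_mul_of_nonneg_left (rpow_neg_tangent_le hb hη0 hy0) hA
      have h2 := mul_nonneg (hvi y hy) (Real.rpow_nonneg hη0.le (-b - 1))
      have h3 : η ^ (1 + b) * η ^ (-b - 1) = 1 := by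
        rw [← Real.rpow_add hη0, show 1 + b + (-b - 1) = 0 by ring, Real.rpow_zero]
      have h4 : (C * η ^ (1 + b) - b * A) * (y - η) * η ^ (-b - 1)
          = C * (y - η) - A * (b * η ^ (-b - 1) * (y - η)) := by
        linear_combination C * (y - η) * h3
      rw [h4] at h2
      linarith

/-! ### The equilibrium problem of the game -/

theorem Offense.level_pos (t : Offense) : 0 < t.level := by cases t <;> norm_num [Offense.level]

namespace Game

variable {J Q : Type*} (G : Game J Q)

open Classical in
/-- The total resource `∑_j x_{jq}` that the plan `x` sends to the target node `q`. -/
noncomputable def load (x : J → Q → ℝ) (q : Q) : ℝ := ∑ e ∈ G.links with e.2 = q, x e.1 e.2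

open Classical in
/-- The coefficient `∑_j c_{jq} x_{jq} ^ β₁` of `η_q ^ (-β₂)` in the adversary's cost. -/
noncomputable def penaltyCoeff (x : J → Q → ℝ) (q : Q) : ℝ :=
  ∑ e ∈ G.links with e.2 = q, G.punishment e.1 e.2 * x e.1 e.2 ^ G.beta₁

/-- The derivative of the adversary's cost at the target node `q` for the sub-type `t`, multiplied
by `ξ_q(t) ^ (1 + β₂)`. Unlike the derivative, it is continuous up to `ξ_q(t) = 0`. -/
noncomputable def scaledSlope (x : J → Q → ℝ) (ξ : Q → Offense → ℝ) (q : Q) (t : Offense) : ℝ :=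
  t.level * G.load x q * ξ q t ^ (1 + G.beta₂) - G.beta₂ * G.penaltyCoeff x q

open Classical in
/-- The adversary's cost is a sum, over the target nodes, of costs that depend only on the action at
the node. -/
theorem adversaryCost_eq_sum [Fintype Q] {x : J → Q → ℝ} (hx : ∀ j q, 0 ≤ x j q) (η : Q → ℝ)
    (θ : Q → Offense) :
    G.adversaryCost x η θ = ∑ q,
      (((ENNReal.ofReal (G.penaltyCoeff x q) * ENNReal.ofReal (η q) ^ (-G.beta₂) : ℝ≥0∞) : EReal)
        + ((∑ e ∈ G.links with e.2 = q, G.perception e.1 e.2 * x e.1 e.2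
          + (θ q).level * G.load x q * η q : ℝ) : EReal)) := by
  rw [adversaryCost, ← Finset.sum_fiberwise G.links (fun e => e.2)]
  refine Finset.sum_congr rfl fun q _ => ?_
  rw [Finset.sum_add_distrib]
  congr 1
  · rw [penaltyCoeff, ENNReal.ofReal_sum_of_nonneg fun e _ =>
      mul_nonneg (G.punishment_nonneg _ _) (Real.rpow_nonneg (hx _ _) _), Finset.sum_mul]
    rw [EReal.coe_ennreal_sum]
    refine Finset.sum_congr rfl fun e he => ?_
    rw [(Finset.mem_filter.1 he).2, ENNReal.ofReal_mul (G.punishment_nonneg _ _),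
      ENNReal.ofReal_rpow_of_nonneg (hx _ _) G.beta₁_mem.1, mul_right_comm]
  · rw [load, Finset.mul_sum, Finset.sum_mul, ← Finset.sum_add_distrib, EReal.coe_sum]
    refine Finset.sum_congr rfl fun e he => ?_
    rw [(Finset.mem_filter.1 he).2]
    congr 1
    ring

theorem load_nonneg {x : J → Q → ℝ} (hx : ∀ j q, 0 ≤ x j q) (q : Q) : 0 ≤ G.load x q :=
  Finset.sum_nonneg fun _ _ => hx _ _

theorem penaltyCoeff_nonneg {x : J → Q → ℝ} (hx : ∀ j q, 0 ≤ x j q) (q : Q) :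
    0 ≤ G.penaltyCoeff x q :=
  Finset.sum_nonneg fun _ _ => mul_nonneg (G.punishment_nonneg _ _) (Real.rpow_nonneg (hx _ _) _)

theorem adversaryCost_le_of_variationalInequality [Fintype Q] {x : J → Q → ℝ}
    (hx : ∀ j q, 0 ≤ x j q) {ξ : Q → Offense → ℝ} (hξ : ξ ∈ Set.Icc 0 G.bound)
    (hvi : ∀ q t, ∀ s ∈ Set.Icc 0 (G.bound q t), 0 ≤ G.scaledSlope x ξ q t * (s - ξ q t))
    {θ : Q → Offense} {η : Q → ℝ} (hη : η ∈ G.actions θ) :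
    G.adversaryCost x (play ξ θ) θ ≤ G.adversaryCost x η θ := by
  rw [G.adversaryCost_eq_sum hx, G.adversaryCost_eq_sum hx]
  exact Finset.sum_le_sum fun q _ => nodeCost_le_of_variationalInequality
    (G.penaltyCoeff_nonneg hx q) (mul_nonneg (θ q).level_pos.le (G.load_nonneg hx q)) G.beta₂_mem
    ⟨hξ.1 q _, hξ.2 q _⟩ (hη q) (hvi q (θ q))

theorem convex_plans [Fintype Q] : Convex ℝ G.plans := by
  rintro x ⟨hx0, hx1, hx2⟩ y ⟨hy0, hy1, hy2⟩ a b ha hb hab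
  refine ⟨fun j q => ?_, fun j q hjq => ?_, fun j => ?_⟩
  · exact add_nonneg (mul_nonneg ha (hx0 j q)) (mul_nonneg hb (hy0 j q))
  · simp [hx1 j q hjq, hy1 j q hjq]
  · calc ∑ q, (a • x + b • y) j q = a * ∑ q, x j q + b * ∑ q, y j q := by
          rw [Finset.mul_sum, Finset.mul_sum, ← Finset.sum_add_distrib]; rfl
      _ ≤ a * G.capacity j + b * G.capacity j :=
          add_le_add (mul_le_mul_of_nonneg_left (hx2 j) ha) (mul_le_mul_of_nonneg_left (hy2 j) hb)
      _ = G.capacity j := by rw [← add_mul, hab, one_mul]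

theorem isCompact_plans [Fintype Q] : IsCompact G.plans := by
  refine (isCompact_Icc (a := (0 : J → Q → ℝ)) (b := fun j _ => G.capacity j)).of_isClosed_subset
    ?_ fun x hx => ⟨hx.1, fun j q => ?_⟩
  · simp only [plans, Set.ofPred_and, Set.ofPred_forall]
    refine IsClosed.inter ?_ (IsClosed.inter ?_ ?_)
    · exact isClosed_iInter fun j => isClosed_iInter fun q =>
        isClosed_le continuous_const (by fun_prop)
    · exact isClosed_iInter fun j => isClosed_iInter fun q => isClosed_iInter fun _ =>
        isClosed_eq (by fun_prop) continuous_const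
    · exact isClosed_iInter fun j => isClosed_le (by fun_prop) continuous_const
  · exact (Finset.single_le_sum (fun q _ => hx.1 j q) (Finset.mem_univ q)).trans (hx.2.2 j)

theorem zero_mem_plans [Fintype Q] : (0 : J → Q → ℝ) ∈ G.plans :=
  ⟨fun _ _ => le_rfl, fun _ _ _ => rfl, fun j => by simpa using (G.capacity_pos j).le⟩

theorem continuous_dispatcherUtility :
    Continuous fun z : (J → Q → ℝ) × (Q → Offense → ℝ) => G.dispatcherUtility z.1 z.2 := by
  unfold dispatcherUtility
  refine continuous_finsetSum _ fun e _ => Continuous.sub (by fun_prop) ?_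
  exact continuous_const.mul (Real.continuous_mul_log.comp
    (by fun_prop : Continuous fun z : (J → Q → ℝ) × (Q → Offense → ℝ) => z.1 e.1 e.2))

theorem concaveOn_dispatcherUtility [Fintype Q] (ξ : Q → Offense → ℝ) :
    ConcaveOn ℝ G.plans fun x => G.dispatcherUtility x ξ := by
  refine ⟨G.convex_plans, fun x hx y hy a b ha hb hab => ?_⟩
  simp only [dispatcherUtility, smul_eq_mul, Finset.mul_sum]
  rw [← Finset.sum_add_distrib]
  refine Finset.sum_le_sum fun e _ => ?_
  have h := mul_le_mul_of_nonneg_left (Real.convexOn_mul_log.2 (hx.1 e.1 e.2) (hy.1 e.1 e.2)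
    ha hb hab) G.regWeight_nonneg
  simp only [smul_eq_mul] at h
  simp only [Pi.add_apply, Pi.smul_apply, smul_eq_mul, ← Finset.sum_mul]
  linarith

theorem continuous_scaledSlope (q : Q) (t : Offense) :
    Continuous fun z : (J → Q → ℝ) × (Q → Offense → ℝ) => G.scaledSlope z.1 z.2 q t := by
  unfold scaledSlope load penaltyCoeff
  refine Continuous.sub (Continuous.mul (by fun_prop) ?_) (continuous_const.mul
    (continuous_finsetSum _ fun e _ => continuous_const.mul ?_))
  · exact (Real.continuous_rpow_const (by linarith [G.beta₂_mem.1])).comp (by fun_prop)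
  · exact (Real.continuous_rpow_const G.beta₁_mem.1).comp (by fun_prop)

/-- The bifunction of the equilibrium problem: the sum of the dispatcher's gain from the deviation
of the plan from `z.1` to `w.1`, and of the adversary's first-order gains, each multiplied by
`ξ_q(t) ^ (1 + β₂)`, from the deviation from `ξ = z.2` to `w.2`. -/
noncomputable def deviationGain [Fintype Q] (z w : (J → Q → ℝ) × (Q → Offense → ℝ)) : ℝ :=
  G.dispatcherUtility w.1 z.2 - G.dispatcherUtility z.1 z.2
    - ∑ q, ∑ t, G.scaledSlope z.1 z.2 q t * (w.2 q t - z.2 q t)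

theorem continuous_deviationGain [Fintype Q] (w : (J → Q → ℝ) × (Q → Offense → ℝ)) :
    Continuous fun z => G.deviationGain z w := by
  unfold deviationGain
  refine Continuous.sub (Continuous.sub ?_ G.continuous_dispatcherUtility)
    (continuous_finsetSum _ fun q _ => continuous_finsetSum _ fun t _ =>
      (G.continuous_scaledSlope q t).mul (by fun_prop))
  exact G.continuous_dispatcherUtility.comp
    (by fun_prop : Continuous fun z : (J → Q → ℝ) × (Q → Offense → ℝ) => (w.1, z.2))

theorem concaveOn_deviationGain [Fintype Q] (z : (J → Q → ℝ) × (Q → Offense → ℝ)) :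
    ConcaveOn ℝ (G.plans ×ˢ Set.Icc 0 G.bound) (G.deviationGain z) := by
  refine ⟨G.convex_plans.prod (convex_Icc _ _), fun v hv w hw a b ha hb hab => ?_⟩
  have h1 := (G.concaveOn_dispatcherUtility z.2).2 hv.1 hw.1 ha hb hab
  have h2 : ∑ q, ∑ t, G.scaledSlope z.1 z.2 q t * ((a • v + b • w).2 q t - z.2 q t)
      = a * ∑ q, ∑ t, G.scaledSlope z.1 z.2 q t * (v.2 q t - z.2 q t)
        + b * ∑ q, ∑ t, G.scaledSlope z.1 z.2 q t * (w.2 q t - z.2 q t) := by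
    simp only [Finset.mul_sum]
    simp only [← Finset.sum_add_distrib]
    refine Finset.sum_congr rfl fun q _ => Finset.sum_congr rfl fun t _ => ?_
    simp only [Prod.snd_add, Prod.smul_snd, Pi.add_apply, Pi.smul_apply, smul_eq_mul]
    linear_combination G.scaledSlope z.1 z.2 q t * z.2 q t * hab
  simp only [deviationGain, h2]
  simp only [smul_eq_mul, Prod.fst_add, Prod.smul_fst] at h1 ⊢
  have h3 : G.dispatcherUtility z.1 z.2
      = a * G.dispatcherUtility z.1 z.2 + b * G.dispatcherUtility z.1 z.2 := by
    rw [← add_mul, hab, one_mul]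
  linarith

theorem isBayesianEquilibrium_of_deviationGain_nonpos [Fintype Q]
    {z : (J → Q → ℝ) × (Q → Offense → ℝ)} (hz : z ∈ G.plans ×ˢ Set.Icc 0 G.bound)
    (h : ∀ w ∈ G.plans ×ˢ Set.Icc 0 G.bound, G.deviationGain z w ≤ 0) :
    G.IsBayesianEquilibrium z.1 z.2 := by
  classical
  refine ⟨hz.1, fun θ q => ⟨hz.2.1 q _, hz.2.2 q _⟩, fun y hy => ?_, fun θ η hη =>
    G.adversaryCost_le_of_variationalInequality hz.1.1 hz.2 (fun q t s hs => ?_) hη⟩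
  · simpa [deviationGain] using h (y, z.2) ⟨hy, hz.2⟩
  · have hw := h (z.1, fun q' t' => if q' = q ∧ t' = t then s else z.2 q' t')
      ⟨hz.1, fun q' t' => ?_, fun q' t' => ?_⟩
    · rw [deviationGain, sub_self, zero_sub, neg_nonpos, Finset.sum_eq_single q,
        Finset.sum_eq_single t] at hw
      · simpa using hw
      · intro t' _ ht'
        simp [ht']
      · simp
      · intro q' _ hq'
        simp [hq']
      · simp
    · by_cases hqt : q' = q ∧ t' = t
      · simpa [hqt] using hs.1
      · simpa [hqt] using hz.2.1 q' t'
    · by_cases hqt : q' = q ∧ t' = t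
      · simpa [hqt] using hs.2
      · simpa [hqt] using hz.2.2 q' t'

end Game

end AdversarialOT

theorem mainTheorem1 {J Q : Type*} [Fintype J] [Fintype Q] (G : AdversarialOT.Game J Q) :
    ∃ (x : J → Q → ℝ) (ξ : Q → AdversarialOT.Offense → ℝ), G.IsBayesianEquilibrium x ξ := by
  obtain ⟨z, hz, h⟩ := (G.isCompact_plans.prod isCompact_Icc).exists_forall_le_zero
    (K := G.plans ×ˢ Set.Icc 0 G.bound) (φ := G.deviationGain)
    ⟨(0, 0), G.zero_mem_plans, le_rfl, G.bound_nonneg⟩ (G.convex_plans.prod (convex_Icc _ _))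
    (fun w _ => (G.continuous_deviationGain w).continuousOn)
    (fun z _ => G.concaveOn_deviationGain z)
    (fun z _ => by simp [AdversarialOT.Game.deviationGain])
  exact ⟨z.1, z.2, G.isBayesianEquilibrium_of_deviationGain_nonpos hz h⟩
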